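/- Let $\gamma$ be a constant with $1\le\gamma\le 2$. A non-tilted spatially homogeneous cosmology of Bianchi type VIII whose source is a perfect fluid with equation of state $p=(\gamma-1)\mu$, $\mu>0$, is represented by an orbit $\tau\mapsto(\Sigma_+,\Sigma_-,N_1,N_+,N_-)$, $\tau>\tau_0$, of the Hubble-normalized evolution equations \[ \begin{aligned} \Sigma_+' &= -(2-q)\Sigma_+ - 2N_-^2 + \tfrac13 N_1(N_1-N_+),\\ \Sigma_-' &= -(2-q)\Sigma_- - N_-(2N_+-N_1),\\ N_1' &= (q-4\Sigma_+)N_1,\\ N_+' &= (q+2\Sigma_+)N_+ + 6\Sigma_-N_-,\\ N_-' &= (q+2\Sigma_+)N_- + 2\Sigma_-N_+, \end{aligned} \] where the deceleration parameter $q$ and the density parameter $\Omega$ are \[ q = 2(\Sigma_+^2+\Sigma_-^2)+\tfrac12(3\gamma-2)\Omega,\qquad \Omega = 1-\Sigma_+^2-\Sigma_-^2-N_-^2-\tfrac1{12}N_1^2+\tfrac13N_1N_+ , \] in the state space \[ N_1<0,\qquad N_+^2-3N_-^2>0,\qquad N_+>0,\qquad \Omega>0 . \] Here ${}'=d/d\tau$,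 and $\tau$ is the dimensionless time for which the overall length scale is $\ell=\ell_0e^{\tau}$. Put \[ R=\sqrt{\Sigma_-^2+N_-^2},\qquad Z=\sqrt{-\tfrac13N_1N_+},\qquad M=\frac1{N_+}. \] Then for every such cosmology \[ \lim_{\tau\to+\infty}(\Sigma_+,R,Z,M)=\left(\tfrac12,\,0,\,\tfrac{\sqrt3}{2},\,0\right). \] If moreover the model is not locally rotationally symmetric, that is, if $R$ is not identically zero, then \[ \lim_{\tau\to+\infty}\frac{M}{R}=0 . \] -/

import Mathlib

open Filter Topology

noncomputable section

namespace BianchiVIII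

/-- A point of the Hubble-normalized state space: shear variables `Sp = Σ₊`, `Sm = Σ₋` and
curvature variables `N1 = N₁`, `Np = N₊ = (N₂ + N₃) / 2`, `Nm = N₋ = (N₂ - N₃) / (2 √3)`. -/
structure State where
  Sp : ℝ
  Sm : ℝ
  N1 : ℝ
  Np : ℝ
  Nm : ℝ

namespace State

/-- The density parameter `Ω = μ / (3 H²)`, expressed through the Gauss (Friedmann) constraint. -/
def density (x : State) : ℝ :=
  1 - x.Sp ^ 2 - x.Sm ^ 2 - x.Nm ^ 2 - (1 / 12) * x.N1 ^ 2 - (-(1 / 3) * x.N1 * x.Np)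

/-- The deceleration parameter `q` for the equation of state `p = (γ - 1) μ`. -/
def decel (γ : ℝ) (x : State) : ℝ :=
  2 * (x.Sp ^ 2 + x.Sm ^ 2) + (1 / 2) * (3 * γ - 2) * x.density

/-- The Bianchi VIII perfect-fluid state space: `N₁ < 0`, `N₂ > 0`, `N₃ > 0` (written in terms of
`N₊`, `N₋`), and non-vacuum, `Ω > 0`. -/
structure IsAdmissible (x : State) : Prop where
  N1_neg : x.N1 < 0
  Np_sq_sub_pos : 0 < x.Np ^ 2 - 3 * x.Nm ^ 2
  Np_pos : 0 < x.Np
  density_pos : 0 < x.density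

/-- The variable `R ≥ 0` of the polar form `Σ₋ = R cos ψ`, `N₋ = R sin ψ`. -/
def R (x : State) : ℝ := √(x.Sm ^ 2 + x.Nm ^ 2)

/-- The variable `Z > 0` with `Z² = -N₁ N₊ / 3`. -/
def Z (x : State) : ℝ := √(-(1 / 3) * x.N1 * x.Np)

/-- The variable `M = 1 / N₊`. -/
def M (x : State) : ℝ := 1 / x.Np

end State

/-- A non-tilted Bianchi VIII cosmology with equation of state `p = (γ - 1) μ`, at times
`τ > τ₀`: an orbit in the state space of the Hubble-normalized evolution equations. The prime of
the equations is differentiation with respect to `τ`, where the length scale is `ℓ = ℓ₀ e ^ τ`. -/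
structure IsCosmology (γ τ₀ : ℝ) (x : ℝ → State) : Prop where
  admissible : ∀ τ, τ₀ < τ → (x τ).IsAdmissible
  deriv_Sp : ∀ τ, τ₀ < τ → HasDerivAt (fun s => (x s).Sp)
    (-(2 - (x τ).decel γ) * (x τ).Sp - 2 * (x τ).Nm ^ 2
      + (1 / 3) * (x τ).N1 * ((x τ).N1 - (x τ).Np)) τ
  deriv_Sm : ∀ τ, τ₀ < τ → HasDerivAt (fun s => (x s).Sm)
    (-(2 - (x τ).decel γ) * (x τ).Sm - (x τ).Nm * (2 * (x τ).Np - (x τ).N1)) τ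
  deriv_N1 : ∀ τ, τ₀ < τ → HasDerivAt (fun s => (x s).N1)
    (((x τ).decel γ - 4 * (x τ).Sp) * (x τ).N1) τ
  deriv_Np : ∀ τ, τ₀ < τ → HasDerivAt (fun s => (x s).Np)
    (((x τ).decel γ + 2 * (x τ).Sp) * (x τ).Np + 6 * (x τ).Sm * (x τ).Nm) τ
  deriv_Nm : ∀ τ, τ₀ < τ → HasDerivAt (fun s => (x s).Nm)
    (((x τ).decel γ + 2 * (x τ).Sp) * (x τ).Nm + 2 * (x τ).Sm * (x τ).Np) τ

/-- The model is locally rotationally symmetric: `R` vanishes identically. -/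
def IsLRS (τ₀ : ℝ) (x : ℝ → State) : Prop := ∀ τ, τ₀ < τ → (x τ).R = 0

end BianchiVIII

end

/-!
Every variable except `N₊` is bounded by the Friedmann constraint, while `Σ₋` and `N₋` oscillate
with a frequency proportional to `N₊`. The oscillation is averaged out by the single correction term
`A = Σ₋ N₋ / N₊`, for which `A' = 2 (Σ₋² - N₋²) + O(M)` and `A = O(M)`: a term `c (Σ₋² - N₋²)` with
slowly varying `c` is, up to `O(M)`, the derivative of `c A / 2`. Four such corrections and one
elementary lemma of Barbalat type (`eventually_lt_of_tendsto_of_le_deriv`) give the theorem.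

* *Exponential decay of `M`* (`IsCosmology.exists_M_le_exp`). The product `V = -N₁ (N₊² - 3 N₋²)`
  satisfies `(log V)' = 3 q ≥ 0`, and `M ≤ 3 / V`. The bounded function `Σ₊ - (3 / 2) A` has
  derivative at least `1 / 2 - K q`, so that `∫ q`, hence `log V`, grows at least linearly. All the
  errors `O(M)` are therefore integrable.
* *Lyapunov function* (`IsCosmology.eventually_lyapunov_lt`). With `f = 1 - Σ₊ / 2`, the function
  `log (Z / f) - (3 / 4) A / f` is bounded above and, up to an error `O(M)`, increases at a rate of
  at least `(4 / 3) (Σ₊ - 1 / 2)² + (γ - 1) Ω`. Hence `Σ₊ → 1 / 2` and `(γ - 1) Ω → 0`.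
* *Decay of `R` and `Ω`* (`IsCosmology.eventually_rsq_add_density_lt`). The convergent function
  `Σ₊ - A (Σ₊ + 1) / 2` has derivative `-(3 / 2) R² - (3 / 4) (2 - γ) Ω + o(1)` or less, so that
  `R → 0` and `(2 - γ) Ω → 0`; the constraint then gives `Z² → 3 / 4`.
* *Decay of `M / R`* (`IsCosmology.tendsto_M_div_R`). In the non-LRS case the derivative of
  `log (M / R) - (3 / 4) A / R²` has limit superior at most `-3 / 2`.
-/

namespace BianchiVIII

open Filter Topology Set

noncomputable section

/-! ### Differential inequalities -/

theorem sub_le_sub_of_deriv_le {f g f' g' : ℝ → ℝ} {a : ℝ}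
    (hf : ∀ t, a ≤ t → HasDerivAt f (f' t) t) (hg : ∀ t, a ≤ t → HasDerivAt g (g' t) t)
    (h : ∀ t, a ≤ t → g' t ≤ f' t) {s t : ℝ} (hs : a ≤ s) (hst : s ≤ t) :
    g t - g s ≤ f t - f s := by
  have hd : ∀ u, a ≤ u → HasDerivAt (fun u => f u - g u) (f' u - g' u) u :=
    fun u hu => (hf u hu).sub (hg u hu)
  have hm : MonotoneOn (fun u => f u - g u) (Ici a) := by
    refine monotoneOn_of_deriv_nonneg (convex_Ici a)
      (fun u hu => (hd u hu).continuousAt.continuousWithinAt)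
      (fun u hu => ?_) (fun u hu => ?_)
    · exact (hd u (interior_subset hu)).differentiableAt.differentiableWithinAt
    · rw [(hd u (interior_subset hu)).deriv]
      linarith [h u (interior_subset hu)]
  have := hm (mem_Ici.2 hs) (mem_Ici.2 (hs.trans hst)) hst
  simp only at this
  linarith

theorem exists_tendsto_of_deriv_nonneg {f f' : ℝ → ℝ} {a B : ℝ}
    (hf : ∀ t, a ≤ t → HasDerivAt f (f' t) t) (h : ∀ t, a ≤ t → 0 ≤ f' t)
    (hB : ∀ t, a ≤ t → f t ≤ B) : ∃ l, Tendsto f atTop (𝓝 l) := by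
  have hmono : Monotone fun t => f (max a t) := fun s t hst => by
    have := sub_le_sub_of_deriv_le hf (fun t _ => hasDerivAt_const t (0 : ℝ)) h
      (le_max_left a s) (max_le_max_left a hst)
    simp only [sub_self] at this
    linarith
  refine ⟨_, (tendsto_atTop_ciSup hmono ⟨B, ?_⟩).congr' ?_⟩
  · rintro _ ⟨t, rfl⟩
    exact hB _ (le_max_left a t)
  · filter_upwards [eventually_ge_atTop a] with t ht
    rw [max_eq_right ht]

/-- A variant of Barbalat's lemma: if `f` converges and `f' ≥ g - e`, where `e → 0` and the
derivative of `g` is bounded below, then the limit superior of `g` is at most `0`. -/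
theorem eventually_lt_of_tendsto_of_le_deriv {f f' g g' e : ℝ → ℝ} {a l K : ℝ}
    (hl : Tendsto f atTop (𝓝 l)) (hf : ∀ t, a ≤ t → HasDerivAt f (f' t) t)
    (hg : ∀ t, a ≤ t → HasDerivAt g (g' t) t) (hK : ∀ t, a ≤ t → -K ≤ g' t)
    (he : Tendsto e atTop (𝓝 0)) (h : ∀ t, a ≤ t → g t - e t ≤ f' t)
    {ε : ℝ} (hε : 0 < ε) : ∀ᶠ t in atTop, g t < ε := by
  have hK1 : 0 < |K| + 1 := by positivity
  set d : ℝ := ε / (2 * (|K| + 1)) with hd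
  have hd0 : 0 < d := by positivity
  have hKd : (|K| + 1) * d = ε / 2 := by rw [hd]; field_simp
  have hdiff : Tendsto (fun t => f (t + d) - f t) atTop (𝓝 0) := by
    simpa using (hl.comp (tendsto_atTop_add_const_right _ d tendsto_id)).sub hl
  obtain ⟨b, hb⟩ := eventually_atTop.1 (he.eventually (gt_mem_nhds (show 0 < ε / 4 by positivity)))
  filter_upwards [hdiff.eventually (gt_mem_nhds (show 0 < d * (ε / 4) by positivity)),
    eventually_ge_atTop a, eventually_ge_atTop b] with t ht hta htb
  by_contra! hgt
  -- On `[t, t + d]` the function `g` stays above `ε / 2`, so `f` gains at least `d * (ε / 4)`.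
  have hlow : ∀ u, t ≤ u → u ≤ t + d → ε / 2 ≤ g u := fun u hu hud => by
    have := sub_le_sub_of_deriv_le hg (fun u _ => (hasDerivAt_id u).const_mul (-(|K| + 1)))
      (fun u hu => by have := hK u hu; have := le_abs_self K; linarith) hta hu
    simp only [id] at this
    nlinarith
  have hderiv : ∀ u ∈ interior (Icc t (t + d)), ε / 4 ≤ deriv f u := fun u hu => by
    have hu' := interior_subset hu
    rw [(hf u (hta.trans hu'.1)).deriv]
    have h1 := h u (hta.trans hu'.1)
    have h2 := hlow u hu'.1 hu'.2
    have h3 := hb u (htb.trans hu'.1)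
    linarith
  have := (convex_Icc t (t + d)).mul_sub_le_image_sub_of_le_deriv
    (fun u hu => (hf u (hta.trans hu.1)).continuousAt.continuousWithinAt)
    (fun u hu => (hf u (hta.trans (interior_subset hu).1)).differentiableAt.differentiableWithinAt)
    hderiv t (left_mem_Icc.2 (by linarith)) (t + d) (right_mem_Icc.2 (by linarith)) (by linarith)
  linarith

theorem tendsto_of_abs_le {f g : ℝ → ℝ} {l : ℝ} (hg : Tendsto g atTop (𝓝 0))
    (h : ∀ᶠ t in atTop, |f t - l| ≤ g t) : Tendsto f atTop (𝓝 l) :=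
  tendsto_iff_norm_sub_tendsto_zero.2
    (squeeze_zero' (Eventually.of_forall fun _ => norm_nonneg _) h hg)

/-! ### Bounds on the state space -/

namespace State

/-- The correction term `Σ₋ N₋ / N₊`. Its derivative is `2 (Σ₋² - N₋²)` up to terms of order
`1 / N₊`, so that subtracting multiples of it removes the rapid oscillation of `Σ₋² - N₋²`. -/
def osc (s : State) : ℝ := s.Sm * s.Nm / s.Np

/-- The product `-N₁ N₂ N₃`, where `N₂ N₃ = N₊² - 3 N₋²`; its logarithmic derivative is `3 q`. -/
def vol (s : State) : ℝ := -s.N1 * (s.Np ^ 2 - 3 * s.Nm ^ 2)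

/-- The right-hand side of the evolution equation of `Σ₊`. -/
def spRate (γ : ℝ) (s : State) : ℝ :=
  -(2 - s.decel γ) * s.Sp - 2 * s.Nm ^ 2 + (1 / 3) * s.N1 * (s.N1 - s.Np)

/-- The right-hand side of the evolution equation of `osc`. -/
def oscRate (γ : ℝ) (s : State) : ℝ :=
  2 * (s.Sm ^ 2 - s.Nm ^ 2) - (2 - s.decel γ) * s.osc + s.N1 * s.M * s.Nm ^ 2 - 6 * s.osc ^ 2

/-- Half the right-hand side of the evolution equation of `R² = Σ₋² + N₋²`. -/
def rRate (γ : ℝ) (s : State) : ℝ :=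
  -(2 - s.decel γ) * s.Sm ^ 2 + (s.decel γ + 2 * s.Sp) * s.Nm ^ 2 + s.Sm * s.Nm * s.N1

namespace IsAdmissible

variable {γ : ℝ} {s : State}

theorem M_pos (h : s.IsAdmissible) : 0 < s.M := one_div_pos.2 h.Np_pos

theorem vol_pos (h : s.IsAdmissible) : 0 < s.vol :=
  mul_pos (neg_pos.2 h.N1_neg) h.Np_sq_sub_pos

theorem zsq_pos (h : s.IsAdmissible) : 0 < -(1 / 3) * s.N1 * s.Np := by
  have := mul_pos (neg_pos.2 h.N1_neg) h.Np_pos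
  linarith

/-- The Friedmann constraint bounds all the variables except `N₊`. -/
theorem sum_lt_one (h : s.IsAdmissible) :
    s.Sp ^ 2 + s.Sm ^ 2 + s.Nm ^ 2 + (1 / 12) * s.N1 ^ 2 + -(1 / 3) * s.N1 * s.Np < 1 := by
  have := h.density_pos
  rw [density] at this
  linarith

theorem Sp_sq_lt (h : s.IsAdmissible) : s.Sp ^ 2 < 1 := by
  linarith [h.sum_lt_one, h.zsq_pos, sq_nonneg s.Sm, sq_nonneg s.Nm, sq_nonneg s.N1]

theorem abs_Sp_lt (h : s.IsAdmissible) : |s.Sp| < 1 := by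
  rw [← sq_lt_one_iff_abs_lt_one]; exact h.Sp_sq_lt

theorem rsq_lt (h : s.IsAdmissible) : s.Sm ^ 2 + s.Nm ^ 2 < 1 := by
  linarith [h.sum_lt_one, h.zsq_pos, sq_nonneg s.Sp, sq_nonneg s.N1]

theorem zsq_lt (h : s.IsAdmissible) : -(1 / 3) * s.N1 * s.Np < 1 := by
  linarith [h.sum_lt_one, sq_nonneg s.Sp, sq_nonneg s.Sm, sq_nonneg s.Nm, sq_nonneg s.N1]

theorem N1_sq_lt (h : s.IsAdmissible) : s.N1 ^ 2 < 12 := by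
  linarith [h.sum_lt_one, h.zsq_pos, sq_nonneg s.Sp, sq_nonneg s.Sm, sq_nonneg s.Nm]

theorem density_lt (h : s.IsAdmissible) : s.density < 1 := by
  rw [density]
  linarith [h.zsq_pos, sq_nonneg s.Sp, sq_nonneg s.Sm, sq_nonneg s.Nm, sq_nonneg s.N1]

theorem abs_N1_le (h : s.IsAdmissible) : |s.N1| ≤ 3 * s.M := by
  rw [abs_of_neg h.N1_neg, M, mul_one_div, le_div_iff₀ h.Np_pos]
  linarith [h.zsq_lt]

theorem N1_sq_le (h : s.IsAdmissible) : s.N1 ^ 2 ≤ 12 * s.M := by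
  have h1 : |s.N1| < 4 := abs_lt_of_sq_lt_sq (by linarith [h.N1_sq_lt]) (by norm_num)
  rw [← sq_abs]
  nlinarith [h.abs_N1_le, abs_nonneg s.N1]

theorem osc_eq (s : State) : s.osc = s.Sm * s.Nm * s.M := by
  rw [osc, M]; ring

theorem abs_mul_le (s : State) : |s.Sm * s.Nm| ≤ (s.Sm ^ 2 + s.Nm ^ 2) / 2 := by
  rw [abs_le]
  constructor <;> nlinarith [sq_nonneg (s.Sm + s.Nm), sq_nonneg (s.Sm - s.Nm)]

theorem abs_osc_le_rsq (h : s.IsAdmissible) :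
    |s.osc| ≤ (s.Sm ^ 2 + s.Nm ^ 2) / 2 * s.M := by
  rw [osc_eq, abs_mul, abs_of_pos h.M_pos]
  exact mul_le_mul_of_nonneg_right (abs_mul_le s) h.M_pos.le

theorem abs_osc_le (h : s.IsAdmissible) : |s.osc| ≤ s.M / 2 := by
  nlinarith [h.abs_osc_le_rsq, h.rsq_lt, h.M_pos]

theorem abs_osc_le_Sm (h : s.IsAdmissible) : |s.osc| ≤ |s.Sm| * s.M := by
  rw [osc_eq, abs_mul, abs_mul, abs_of_pos h.M_pos]
  have : |s.Nm| ≤ 1 := by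
    rw [← sq_le_one_iff_abs_le_one]; linarith [h.rsq_lt, sq_nonneg s.Sm]
  exact mul_le_mul_of_nonneg_right (mul_le_of_le_one_right (abs_nonneg _) this) h.M_pos.le

theorem abs_osc_le_one (h : s.IsAdmissible) : |s.osc| ≤ 1 := by
  have h1 : |s.Nm| ≤ s.Np := abs_le_of_sq_le_sq (by
    linarith [h.Np_sq_sub_pos, sq_nonneg s.Nm]) h.Np_pos.le
  have h2 : |s.Sm| ≤ 1 := by
    rw [← sq_le_one_iff_abs_le_one]; linarith [h.rsq_lt, sq_nonneg s.Nm]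
  rw [osc, abs_div, abs_of_pos h.Np_pos, div_le_iff₀ h.Np_pos, abs_mul]
  exact mul_le_mul h2 h1 (abs_nonneg _) zero_le_one

theorem osc_sq_le (h : s.IsAdmissible) : s.osc ^ 2 ≤ s.M := by
  rw [← sq_abs]
  nlinarith [h.abs_osc_le_one, h.abs_osc_le, abs_nonneg s.osc, h.M_pos]

theorem M_le (h : s.IsAdmissible) : s.M ≤ 3 / s.vol := by
  rw [M, div_le_div_iff₀ h.Np_pos h.vol_pos, vol]
  have h1 := mul_le_mul_of_nonneg_right h.zsq_lt.le h.Np_pos.le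
  have h2 := mul_nonneg (neg_pos.2 h.N1_neg).le (sq_nonneg s.Nm)
  nlinarith

theorem decel_nonneg (h : s.IsAdmissible) (h₁ : 1 ≤ γ) : 0 ≤ s.decel γ := by
  rw [decel]
  have := mul_nonneg (show 0 ≤ 1 / 2 * (3 * γ - 2) by linarith) h.density_pos.le
  linarith [sq_nonneg s.Sp, sq_nonneg s.Sm]

theorem density_le_decel (h : s.IsAdmissible) (h₁ : 1 ≤ γ) :
    2 * (s.Sp ^ 2 + s.Sm ^ 2) + 1 / 2 * s.density ≤ s.decel γ := by
  rw [decel]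
  nlinarith [h.density_pos]

theorem decel_le (h : s.IsAdmissible) (h₂ : γ ≤ 2) : s.decel γ ≤ 2 := by
  have h3 : s.decel γ ≤ 2 * (s.Sp ^ 2 + s.Sm ^ 2) + 2 * s.density := by
    rw [decel]; nlinarith [h.density_pos]
  rw [density] at h3
  linarith [h.zsq_pos, sq_nonneg s.Nm, sq_nonneg s.N1]

theorem abs_decel_mul_Sp_le (h : s.IsAdmissible) (h₁ : 1 ≤ γ) (h₂ : γ ≤ 2) :
    |(2 - s.decel γ) * s.Sp| ≤ 2 := by
  rw [abs_mul, abs_of_nonneg (by linarith [h.decel_le h₂])]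
  nlinarith [h.abs_Sp_lt, abs_nonneg s.Sp, h.decel_nonneg h₁, h.decel_le h₂]

theorem abs_spRate_le (h : s.IsAdmissible) (h₁ : 1 ≤ γ) (h₂ : γ ≤ 2) :
    |s.spRate γ| ≤ 10 := by
  have h3 := abs_le.1 (h.abs_decel_mul_Sp_le h₁ h₂)
  rw [spRate, abs_le]
  constructor <;>
    nlinarith [h.zsq_pos, h.zsq_lt, h.rsq_lt, h.N1_sq_lt, sq_nonneg s.Sm, sq_nonneg s.Nm,
      sq_nonneg s.N1]

theorem abs_rRate_le (h : s.IsAdmissible) (h₁ : 1 ≤ γ) (h₂ : γ ≤ 2) :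
    |s.rRate γ| ≤ 6 * (s.Sm ^ 2 + s.Nm ^ 2) := by
  have hN : |s.N1| < 4 := abs_lt_of_sq_lt_sq (by linarith [h.N1_sq_lt]) (by norm_num)
  have h3 : |s.Sm * s.Nm * s.N1| ≤ 2 * (s.Sm ^ 2 + s.Nm ^ 2) := by
    rw [abs_mul]
    nlinarith [abs_mul_le s, abs_nonneg (s.Sm * s.Nm), abs_nonneg s.N1]
  have h4 := abs_le.1 h3
  have h5 := abs_lt.1 h.abs_Sp_lt
  have h6 := h.decel_nonneg h₁
  have h7 := h.decel_le h₂
  rw [rRate, abs_le]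
  constructor <;> nlinarith [sq_nonneg s.Sm, sq_nonneg s.Nm,
    mul_nonneg (sub_nonneg.2 h7) (sq_nonneg s.Sm), mul_nonneg h6 (sq_nonneg s.Sm),
    mul_nonneg (sub_nonneg.2 h7) (sq_nonneg s.Nm), mul_nonneg h6 (sq_nonneg s.Nm),
    mul_nonneg (sub_nonneg.2 h5.2.le) (sq_nonneg s.Nm),
    mul_nonneg (sub_nonneg.2 h5.1.le) (sq_nonneg s.Nm)]

end IsAdmissible

end State

/-! ### Evolution equations of derived quantities -/

namespace IsCosmology

variable {γ τ₀ : ℝ} {x : ℝ → State}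

theorem deriv_osc (hx : IsCosmology γ τ₀ x) {τ : ℝ} (hτ : τ₀ < τ) :
    HasDerivAt (fun t => (x t).osc) ((x τ).oscRate γ) τ := by
  have hN := (hx.admissible τ hτ).Np_pos.ne'
  refine (((hx.deriv_Sm τ hτ).mul (hx.deriv_Nm τ hτ)).div (hx.deriv_Np τ hτ) hN).congr_deriv ?_
  simp only [State.oscRate, State.osc, State.M, Pi.mul_apply]
  field_simp
  ring

theorem deriv_vol (hx : IsCosmology γ τ₀ x) {τ : ℝ} (hτ : τ₀ < τ) :
    HasDerivAt (fun t => (x t).vol) (3 * (x τ).decel γ * (x τ).vol) τ := by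
  refine ((hx.deriv_N1 τ hτ).neg.mul (((hx.deriv_Np τ hτ).pow 2).sub
    (((hx.deriv_Nm τ hτ).pow 2).const_mul 3))).congr_deriv ?_
  simp only [State.vol, Pi.neg_apply, Pi.sub_apply, Pi.pow_apply]
  push_cast
  ring

theorem deriv_density (hx : IsCosmology γ τ₀ x) {τ : ℝ} (hτ : τ₀ < τ) :
    HasDerivAt (fun t => (x t).density)
      ((2 * (x τ).decel γ - (3 * γ - 2)) * (x τ).density) τ := by
  refine ((((((hx.deriv_Sp τ hτ).pow 2).const_sub 1).sub ((hx.deriv_Sm τ hτ).pow 2)).sub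
    ((hx.deriv_Nm τ hτ).pow 2)).sub (((hx.deriv_N1 τ hτ).pow 2).const_mul (1 / 12))).sub
    (((hx.deriv_N1 τ hτ).const_mul (-(1 / 3))).mul (hx.deriv_Np τ hτ)) |>.congr_deriv ?_
  simp only [State.decel, State.density]
  push_cast
  ring

theorem deriv_zsq (hx : IsCosmology γ τ₀ x) {τ : ℝ} (hτ : τ₀ < τ) :
    HasDerivAt (fun t => -(1 / 3) * (x t).N1 * (x t).Np)
      ((2 * (x τ).decel γ - 2 * (x τ).Sp + 6 * (x τ).osc) *
        (-(1 / 3) * (x τ).N1 * (x τ).Np)) τ := by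
  have hN := (hx.admissible τ hτ).Np_pos.ne'
  refine (((hx.deriv_N1 τ hτ).const_mul (-(1 / 3))).mul (hx.deriv_Np τ hτ)).congr_deriv ?_
  simp only [State.osc]
  field_simp
  ring

theorem deriv_rsq (hx : IsCosmology γ τ₀ x) {τ : ℝ} (hτ : τ₀ < τ) :
    HasDerivAt (fun t => (x t).Sm ^ 2 + (x t).Nm ^ 2) (2 * (x τ).rRate γ) τ := by
  refine (((hx.deriv_Sm τ hτ).pow 2).add ((hx.deriv_Nm τ hτ).pow 2)).congr_deriv ?_
  simp only [State.rRate]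
  push_cast
  ring

theorem deriv_log_M (hx : IsCosmology γ τ₀ x) {τ : ℝ} (hτ : τ₀ < τ) :
    HasDerivAt (fun t => Real.log (x t).M)
      (-((x τ).decel γ + 2 * (x τ).Sp + 6 * (x τ).osc)) τ := by
  have hN := (hx.admissible τ hτ).Np_pos.ne'
  have : (fun t => Real.log (x t).M) = fun t => -Real.log (x t).Np := by
    funext t; rw [State.M, one_div, Real.log_inv]
  rw [this]
  refine ((hx.deriv_Np τ hτ).log hN).neg.congr_deriv ?_
  simp only [State.osc]
  field_simp

end IsCosmology

/-! ### Estimates of the averaged rates -/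

namespace State.IsAdmissible

variable {γ : ℝ} {s : State}

/-- The terms in `N₋²` cancel in the derivative of `Σ₊ - (3 / 2) osc`. What remains is the constant
`1` from the Friedmann constraint, nonnegative terms, and terms controlled by `q`. -/
theorem half_le_growth (h : s.IsAdmissible) (h₁ : 1 ≤ γ) (h₂ : γ ≤ 2) {m : ℝ} (hm : s.M ≤ m) :
    1 / 2 ≤ s.spRate γ - 3 / 2 * s.oscRate γ + (7 + 9 * m ^ 2) * s.decel γ := by
  have hq := h.density_le_decel h₁
  have hq0 := h.decel_nonneg h₁
  have hq2 := h.decel_le h₂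
  have hM := h.M_pos
  have hΩ := h.density_pos
  have h3 := abs_le.1 (h.abs_decel_mul_Sp_le h₁ h₂)
  have hSp : (2 - s.decel γ) * s.Sp ≤ 1 / 4 + 4 * s.Sp ^ 2 := by
    have : (2 - s.decel γ) * s.Sp ≤ 2 * |s.Sp| := by
      nlinarith [le_abs_self s.Sp, abs_nonneg s.Sp]
    nlinarith [sq_nonneg (|s.Sp| - 1 / 4), sq_abs s.Sp]
  have hosc : -(1 / 4 + 9 * m ^ 2 * s.Sm ^ 2) ≤ 3 / 2 * ((2 - s.decel γ) * s.osc) := by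
    have h5 : |s.osc| ≤ |s.Sm| * m :=
      h.abs_osc_le_Sm.trans (mul_le_mul_of_nonneg_left hm (abs_nonneg _))
    have h6 : -(2 * |s.osc|) ≤ (2 - s.decel γ) * s.osc := by
      nlinarith [neg_abs_le s.osc, abs_nonneg s.osc]
    nlinarith [sq_nonneg (3 * m * |s.Sm| - 1 / 2), sq_abs s.Sm]
  have hN : 0 ≤ -(s.N1 * s.M * s.Nm ^ 2) := by
    have := mul_nonneg (mul_nonneg (neg_pos.2 h.N1_neg).le hM.le) (sq_nonneg s.Nm)
    linarith
  have hm2 : m ^ 2 * s.Sm ^ 2 ≤ m ^ 2 * s.decel γ :=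
    mul_le_mul_of_nonneg_left (by linarith [sq_nonneg s.Sp, sq_nonneg s.Sm]) (sq_nonneg m)
  rw [spRate, oscRate]
  have hd : s.density =
    1 - s.Sp ^ 2 - s.Sm ^ 2 - s.Nm ^ 2 - (1 / 12) * s.N1 ^ 2 - (-(1 / 3) * s.N1 * s.Np) := rfl
  nlinarith [sq_nonneg s.Sp, sq_nonneg s.Sm, sq_nonneg s.N1, sq_nonneg s.osc]

/-- The expression on the right is the derivative of
`log Z - log (1 - Σ₊ / 2) - (3 / 4) osc / (1 - Σ₊ / 2)`. The factor `1 - Σ₊ / 2` is the one for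
which the terms not involving `Ω` complete to the square `2 (Σ₊ - 1 / 2)²`. -/
theorem le_lyapunovRate (h : s.IsAdmissible) (h₁ : 1 ≤ γ) (h₂ : γ ≤ 2) :
    4 / 3 * (s.Sp - 1 / 2) ^ 2 + (γ - 1) * s.density - 11 * s.M ≤
      s.decel γ - s.Sp + 3 * s.osc + s.spRate γ / 2 / (1 - s.Sp / 2)
        - 3 / 4 * (s.oscRate γ / (1 - s.Sp / 2)
          + s.osc * (s.spRate γ / 2) / (1 - s.Sp / 2) ^ 2) := by
  have hSp := abs_lt.1 h.abs_Sp_lt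
  obtain ⟨f, hf⟩ : ∃ f, f = 1 - s.Sp / 2 := ⟨_, rfl⟩
  have hf1 : 1 / 2 ≤ f := by linarith
  have hf2 : f ≤ 3 / 2 := by linarith
  have hf0 : 0 < f := by linarith
  have hM := h.M_pos
  have hN : 0 ≤ -(s.N1 * s.M * s.Nm ^ 2) := by
    have := mul_nonneg (mul_nonneg (neg_pos.2 h.N1_neg).le hM.le) (sq_nonneg s.Nm)
    linarith
  have hgain : s.decel γ - s.Sp + 3 * s.osc + s.spRate γ / 2 / f
        - 3 / 4 * (s.oscRate γ / f + s.osc * (s.spRate γ / 2) / f ^ 2) =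
      (2 * (s.Sp - 1 / 2) ^ 2 + 3 / 2 * (γ - 1) * s.density + s.N1 ^ 2 / 8
        + 3 / 4 * -(s.N1 * s.M * s.Nm ^ 2) + 9 / 2 * s.osc ^ 2) / f
      + (3 * s.osc + 3 / 4 * (2 - s.decel γ) * s.osc / f
        - 3 / 8 * s.osc * s.spRate γ / f ^ 2) := by
    have hd : s.density = 1 - s.Sp ^ 2 - s.Sm ^ 2 - s.Nm ^ 2 - (1 / 12) * s.N1 ^ 2
      - (-(1 / 3) * s.N1 * s.Np) := rfl
    have key : (s.decel γ - s.Sp) * f + s.spRate γ / 2 - 3 / 4 * s.oscRate γ =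
        2 * (s.Sp - 1 / 2) ^ 2 + 3 / 2 * (γ - 1) * s.density + s.N1 ^ 2 / 8
        + 3 / 4 * -(s.N1 * s.M * s.Nm ^ 2) + 9 / 2 * s.osc ^ 2
        + 3 / 4 * (2 - s.decel γ) * s.osc := by
      have hq : s.decel γ = 2 * (s.Sp ^ 2 + s.Sm ^ 2) + 1 / 2 * (3 * γ - 2) * s.density := rfl
      rw [hf, spRate, oscRate]
      linear_combination hq + (1 / 2) * hd
    field_simp
    linear_combination (64 * f) * key
  rw [← hf, hgain]
  have hmain : 4 / 3 * (s.Sp - 1 / 2) ^ 2 + (γ - 1) * s.density ≤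
      (2 * (s.Sp - 1 / 2) ^ 2 + 3 / 2 * (γ - 1) * s.density + s.N1 ^ 2 / 8
        + 3 / 4 * -(s.N1 * s.M * s.Nm ^ 2) + 9 / 2 * s.osc ^ 2) / f := by
    rw [le_div_iff₀ hf0]
    have h3 := mul_nonneg (sub_nonneg.2 h₁) h.density_pos.le
    nlinarith [sq_nonneg (s.Sp - 1 / 2), sq_nonneg s.N1, sq_nonneg s.osc,
      mul_nonneg (sub_nonneg.2 hf2) h3, mul_nonneg (sub_nonneg.2 hf2) (sq_nonneg (s.Sp - 1 / 2))]
  have herr : |3 * s.osc + 3 / 4 * (2 - s.decel γ) * s.osc / f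
        - 3 / 8 * s.osc * s.spRate γ / f ^ 2| ≤ 21 * |s.osc| := by
    have e : 3 * s.osc + 3 / 4 * (2 - s.decel γ) * s.osc / f
        - 3 / 8 * s.osc * s.spRate γ / f ^ 2 =
        (3 + 3 / 4 * (2 - s.decel γ) * f⁻¹ - 3 / 8 * s.spRate γ * (f⁻¹) ^ 2) * s.osc := by
      field_simp
    rw [e, abs_mul]
    refine mul_le_mul_of_nonneg_right ?_ (abs_nonneg _)
    have hi0 : 0 < f⁻¹ := inv_pos.2 hf0
    have hi : f⁻¹ ≤ 2 := by
      rw [inv_le_comm₀ hf0 two_pos]; linarith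
    have hi2 : (f⁻¹) ^ 2 ≤ 4 := by nlinarith
    have hi3 : 0 < (f⁻¹) ^ 2 := by positivity
    have h5 := abs_le.1 (h.abs_spRate_le h₁ h₂)
    have h6 := h.decel_nonneg h₁
    have h7 := h.decel_le h₂
    have h8 : (2 - s.decel γ) * f⁻¹ ≤ 4 := by nlinarith
    have h9 : 0 ≤ (2 - s.decel γ) * f⁻¹ := mul_nonneg (by linarith) hi0.le
    rw [abs_le]
    constructor <;> nlinarith
  linarith [(abs_le.1 herr).1, h.abs_osc_le]

/-- The expression on the left is the derivative of `Σ₊ - osc * (Σ₊ + 1) / 2`. -/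
theorem spRate_corrected_le (h : s.IsAdmissible) (h₁ : 1 ≤ γ) (h₂ : γ ≤ 2) :
    s.spRate γ - (s.oscRate γ * (s.Sp + 1) + s.osc * s.spRate γ) / 2 ≤
      (12 * |s.Sp - 1 / 2| + 20 * s.M)
        - (3 / 2 * (s.Sm ^ 2 + s.Nm ^ 2) + 3 / 4 * (2 - γ) * s.density) := by
  have hSp := abs_lt.1 h.abs_Sp_lt
  have hM := h.M_pos
  have hosc := h.abs_osc_le
  have hdens : s.density = 1 - s.Sp ^ 2 - s.Sm ^ 2 - s.Nm ^ 2 - (1 / 12) * s.N1 ^ 2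
      - (-(1 / 3) * s.N1 * s.Np) := rfl
  have hq : s.decel γ = 2 * (s.Sp ^ 2 + s.Sm ^ 2) + 1 / 2 * (3 * γ - 2) * s.density := rfl
  have key : s.spRate γ - (s.oscRate γ * (s.Sp + 1) + s.osc * s.spRate γ) / 2 =
      -(3 / 2 * (s.Sm ^ 2 + s.Nm ^ 2) + 3 / 4 * (2 - γ) * s.density)
      + (s.Sp - 1 / 2) * (-2 * (1 - s.Sp ^ 2) + (s.Sm ^ 2 + s.Nm ^ 2)
          + (3 * γ - 2) / 2 * s.density)
      + s.N1 ^ 2 / 4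
      + (s.osc * ((2 - s.decel γ) * (s.Sp + 1) / 2 - s.spRate γ / 2)
          - s.N1 * s.M * s.Nm ^ 2 * (s.Sp + 1) / 2 + 3 * s.osc ^ 2 * (s.Sp + 1)) := by
    rw [oscRate, spRate]
    linear_combination s.Sp * hq + hdens
  have e1 : (s.Sp - 1 / 2) * (-2 * (1 - s.Sp ^ 2) + (s.Sm ^ 2 + s.Nm ^ 2)
          + (3 * γ - 2) / 2 * s.density) ≤ |s.Sp - 1 / 2| * 12 := by
    refine (le_abs_self _).trans ?_
    rw [abs_mul]
    refine mul_le_mul_of_nonneg_left ?_ (abs_nonneg _)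
    have := h.rsq_lt
    have := h.density_lt
    have := h.density_pos
    have := h.Sp_sq_lt
    rw [abs_le]
    constructor <;> nlinarith [sq_nonneg s.Sp, sq_nonneg s.Sm, sq_nonneg s.Nm]
  have e2 : s.osc * ((2 - s.decel γ) * (s.Sp + 1) / 2 - s.spRate γ / 2) ≤ s.M / 2 * 7 := by
    refine (le_abs_self _).trans ?_
    rw [abs_mul]
    refine mul_le_mul hosc ?_ (abs_nonneg _) (by positivity)
    have h5 := abs_le.1 (h.abs_spRate_le h₁ h₂)
    have h6 := h.decel_nonneg h₁
    have h7 := h.decel_le h₂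
    rw [abs_le]
    constructor <;> nlinarith
  have e3 : -(s.N1 * s.M * s.Nm ^ 2 * (s.Sp + 1) / 2) ≤ 4 * s.M := by
    have hN : |s.N1| < 4 := abs_lt_of_sq_lt_sq (by linarith [h.N1_sq_lt]) (by norm_num)
    have : -(s.N1 * s.M * s.Nm ^ 2 * (s.Sp + 1) / 2) =
      s.M * (-s.N1 * (s.Nm ^ 2 * ((s.Sp + 1) / 2))) := by ring
    rw [this, mul_comm 4]
    refine mul_le_mul_of_nonneg_left ?_ hM.le
    have h5 : s.Nm ^ 2 * ((s.Sp + 1) / 2) ≤ 1 := by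
      nlinarith [h.rsq_lt, sq_nonneg s.Sm, sq_nonneg s.Nm]
    have h6 : 0 ≤ s.Nm ^ 2 * ((s.Sp + 1) / 2) := mul_nonneg (sq_nonneg _) (by linarith)
    nlinarith [(abs_lt.1 hN).1, h.N1_neg]
  have e4 : 3 * s.osc ^ 2 * (s.Sp + 1) ≤ 6 * s.M := by
    have := mul_le_mul h.osc_sq_le (show s.Sp + 1 ≤ 2 by linarith) (by linarith) hM.le
    linarith
  rw [key]
  linarith [h.N1_sq_le]

end State.IsAdmissible

/-! ### Limits along a cosmology -/

namespace IsCosmology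

variable {γ τ₀ : ℝ} {x : ℝ → State}

/-- `N₊` grows exponentially. -/
theorem exists_M_le_exp (hx : IsCosmology γ τ₀ x) (h₁ : 1 ≤ γ) (h₂ : γ ≤ 2) :
    ∃ C δ : ℝ, 0 < C ∧ 0 < δ ∧ ∀ t, τ₀ + 1 ≤ t → (x t).M ≤ C * Real.exp (-δ * t) := by
  set a := τ₀ + 1 with ha
  have hlt : ∀ t, a ≤ t → τ₀ < t := fun t ht => by linarith
  have hadm : ∀ t, a ≤ t → (x t).IsAdmissible := fun t ht => hx.admissible t (hlt t ht)
  have hlog : ∀ t, a ≤ t → HasDerivAt (fun t => Real.log (x t).vol) (3 * (x t).decel γ) t :=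
    fun t ht => ((hx.deriv_vol (hlt t ht)).log (hadm t ht).vol_pos.ne').congr_deriv
      (mul_div_cancel_right₀ _ (hadm t ht).vol_pos.ne')
  have hmono : ∀ t, a ≤ t → Real.log (x a).vol ≤ Real.log (x t).vol := fun t ht => by
    have := sub_le_sub_of_deriv_le hlog (fun t _ => hasDerivAt_const t (0 : ℝ))
      (fun t ht => by have := (hadm t ht).decel_nonneg h₁; linarith) le_rfl ht
    simp only [sub_self] at this
    linarith
  set m := 3 / (x a).vol with hm
  have hm0 : 0 < m := div_pos three_pos (hadm a le_rfl).vol_pos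
  have hM : ∀ t, a ≤ t → (x t).M ≤ m := fun t ht => by
    refine (hadm t ht).M_le.trans (div_le_div_of_nonneg_left zero_le_three
      (hadm a le_rfl).vol_pos ?_)
    exact (Real.log_le_log_iff (hadm a le_rfl).vol_pos (hadm t ht).vol_pos).1 (hmono t ht)
  set k := (7 + 9 * m ^ 2) / 3 with hk
  have hk0 : 0 < k := by positivity
  have hH : ∀ t, a ≤ t → |(x t).Sp - 3 / 2 * (x t).osc| ≤ 1 + m := fun t ht => by
    have h3 := abs_lt.1 (hadm t ht).abs_Sp_lt
    have h4 := abs_le.1 (hadm t ht).abs_osc_le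
    have h5 := hM t ht
    rw [abs_le]
    constructor <;> linarith
  have hgrow : ∀ t, a ≤ t →
      1 / 2 * (t - a) + k * Real.log (x a).vol - 2 * (1 + m) ≤ k * Real.log (x t).vol := by
    intro t ht
    have := sub_le_sub_of_deriv_le
      (fun t ht => (((hx.deriv_Sp t (hlt t ht)).sub
        ((hx.deriv_osc (hlt t ht)).const_mul (3 / 2))).add ((hlog t ht).const_mul k)))
      (fun t _ => (hasDerivAt_id t).const_mul (1 / 2))
      (fun t ht => by
        have := (hadm t ht).half_le_growth h₁ h₂ (hM t ht)
        rw [State.spRate] at this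
        rw [hk]
        linarith) le_rfl ht
    simp only [id, Pi.sub_apply, Pi.add_apply] at this
    have h3 := abs_le.1 (hH t ht)
    have h4 := abs_le.1 (hH a le_rfl)
    linarith [h3.1, h3.2, h4.1, h4.2]
  set c := (1 / 2 * -a + k * Real.log (x a).vol - 2 * (1 + m)) / k with hc
  refine ⟨3 * Real.exp (-c), 1 / (2 * k), by positivity, by positivity, fun t ht => ?_⟩
  have hv : c + 1 / (2 * k) * t ≤ Real.log (x t).vol := by
    have e : c + 1 / (2 * k) * t =
        (1 / 2 * (t - a) + k * Real.log (x a).vol - 2 * (1 + m)) / k := by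
      rw [hc]; field_simp; ring
    rw [e, div_le_iff₀ hk0, mul_comm _ k]
    exact hgrow t ht
  refine (hadm t ht).M_le.trans ?_
  rw [div_le_iff₀ (hadm t ht).vol_pos, mul_assoc, mul_assoc, ← Real.exp_log (hadm t ht).vol_pos,
    ← Real.exp_add, ← Real.exp_add]
  have : (1 : ℝ) ≤ Real.exp (-c + (-(1 / (2 * k)) * t + Real.log (x t).vol)) :=
    Real.one_le_exp (by linarith)
  linarith

theorem tendsto_M (hx : IsCosmology γ τ₀ x) (h₁ : 1 ≤ γ) (h₂ : γ ≤ 2) :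
    Tendsto (fun t => (x t).M) atTop (𝓝 0) := by
  obtain ⟨C, δ, -, hδ, hM⟩ := hx.exists_M_le_exp h₁ h₂
  have h0 : Tendsto (fun t => C * Real.exp (-δ * t)) atTop (𝓝 (C * 0)) :=
    (Real.tendsto_exp_atBot.comp
      (tendsto_id.const_mul_atTop_of_neg (neg_lt_zero.2 hδ))).const_mul C
  rw [mul_zero] at h0
  refine tendsto_of_tendsto_of_tendsto_of_le_of_le' tendsto_const_nhds h0 ?_ ?_
  · filter_upwards [eventually_gt_atTop τ₀] with t ht using (hx.admissible t ht).M_pos.le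
  · filter_upwards [eventually_ge_atTop (τ₀ + 1)] with t ht using hM t ht

/-- The Lyapunov function `log (Z / (1 - Σ₊ / 2))`, corrected by a multiple of `osc`, increases up
to an integrable error, at a rate of at least `(4 / 3) (Σ₊ - 1 / 2)² + (γ - 1) Ω`. -/
theorem eventually_lyapunov_lt (hx : IsCosmology γ τ₀ x) (h₁ : 1 ≤ γ) (h₂ : γ ≤ 2)
    {ε : ℝ} (hε : 0 < ε) : ∀ᶠ t in atTop,
      4 / 3 * ((x t).Sp - 1 / 2) ^ 2 + (γ - 1) * (x t).density < ε := by
  obtain ⟨C, δ, hC, hδ, hM⟩ := hx.exists_M_le_exp h₁ h₂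
  set a := τ₀ + 1 with ha
  have hlt : ∀ t, a ≤ t → τ₀ < t := fun t ht => by linarith
  have hadm : ∀ t, a ≤ t → (x t).IsAdmissible := fun t ht => hx.admissible t (hlt t ht)
  have hf0 : ∀ t, a ≤ t → 1 / 2 ≤ 1 - (x t).Sp / 2 := fun t ht => by
    linarith [(abs_lt.1 (hadm t ht).abs_Sp_lt).2]
  have hf : ∀ t, a ≤ t → HasDerivAt (fun t => 1 - (x t).Sp / 2) (-((x t).spRate γ / 2)) t :=
    fun t ht => ((hx.deriv_Sp t (hlt t ht)).div_const 2).const_sub 1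
  have hexp : ∀ t, HasDerivAt (fun t => 11 * C / δ * Real.exp (-δ * t))
      (-(11 * (C * Real.exp (-δ * t)))) t := fun t => by
    refine ((((hasDerivAt_id t).const_mul (-δ)).exp).const_mul (11 * C / δ)).congr_deriv ?_
    simp only [id]
    field_simp
  have hL : ∀ t, a ≤ t → HasDerivAt
      (fun t => 1 / 2 * Real.log (-(1 / 3) * (x t).N1 * (x t).Np) - Real.log (1 - (x t).Sp / 2)
        - 3 / 4 * ((x t).osc / (1 - (x t).Sp / 2)) - 11 * C / δ * Real.exp (-δ * t))
      ((x t).decel γ - (x t).Sp + 3 * (x t).osc + (x t).spRate γ / 2 / (1 - (x t).Sp / 2)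
        - 3 / 4 * ((x t).oscRate γ / (1 - (x t).Sp / 2)
          + (x t).osc * ((x t).spRate γ / 2) / (1 - (x t).Sp / 2) ^ 2)
        + 11 * (C * Real.exp (-δ * t))) t := fun t ht => by
    have hf0t : 1 - (x t).Sp / 2 ≠ 0 := by linarith [hf0 t ht]
    have hz := (hadm t ht).zsq_pos.ne'
    refine ((((((hx.deriv_zsq (hlt t ht)).log hz).const_mul (1 / 2)).sub
      ((hf t ht).log hf0t)).sub
      (((hx.deriv_osc (hlt t ht)).div (hf t ht) hf0t).const_mul (3 / 4))).sub
      (hexp t)).congr_deriv ?_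
    rw [mul_div_cancel_right₀ _ hz]
    obtain ⟨f, hf⟩ : ∃ f, f = 1 - (x t).Sp / 2 := ⟨_, rfl⟩
    rw [← hf] at hf0t ⊢
    field_simp
    ring
  have hrate : ∀ t, a ≤ t → 4 / 3 * ((x t).Sp - 1 / 2) ^ 2 + (γ - 1) * (x t).density ≤
      (x t).decel γ - (x t).Sp + 3 * (x t).osc + (x t).spRate γ / 2 / (1 - (x t).Sp / 2)
        - 3 / 4 * ((x t).oscRate γ / (1 - (x t).Sp / 2)
          + (x t).osc * ((x t).spRate γ / 2) / (1 - (x t).Sp / 2) ^ 2)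
        + 11 * (C * Real.exp (-δ * t)) := fun t ht => by
    linarith [(hadm t ht).le_lyapunovRate h₁ h₂, hM t ht]
  -- The exponential makes up for the error `11 M`, so that the corrected function is monotone.
  obtain ⟨l, hl⟩ := exists_tendsto_of_deriv_nonneg hL
    (B := Real.log 2 + 3 / 4 * (C * Real.exp (-δ * a)))
    (fun t ht => (by
      have := mul_nonneg (sub_nonneg.2 h₁) (hadm t ht).density_pos.le
      positivity : (0 : ℝ) ≤ _).trans (hrate t ht)) (fun t ht => by
    have hft := hf0 t ht
    have hft0 : 0 < 1 - (x t).Sp / 2 := by linarith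
    have b1 := Real.log_nonpos (hadm t ht).zsq_pos.le (hadm t ht).zsq_lt.le
    have b2 : -Real.log 2 ≤ Real.log (1 - (x t).Sp / 2) := by
      rw [← Real.log_inv]
      exact Real.log_le_log (by norm_num) (by linarith)
    have b3 : |(x t).osc / (1 - (x t).Sp / 2)| ≤ C * Real.exp (-δ * a) := by
      have hexp_le : Real.exp (-δ * t) ≤ Real.exp (-δ * a) := Real.exp_le_exp.2 (by nlinarith)
      have := mul_le_mul_of_nonneg_left hexp_le hC.le
      have h3 := (hadm t ht).abs_osc_le
      have h4 := hM t ht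
      have h5 := (hadm t ht).M_pos
      rw [abs_div, abs_of_pos hft0, div_le_iff₀ hft0]
      nlinarith
    have b4 : 0 ≤ 11 * C / δ * Real.exp (-δ * t) := by positivity
    linarith [(abs_le.1 b3).1])
  have hg : ∀ t, a ≤ t → HasDerivAt
      (fun t => 4 / 3 * ((x t).Sp - 1 / 2) ^ 2 + (γ - 1) * (x t).density)
      (8 / 3 * ((x t).Sp - 1 / 2) * (x t).spRate γ
        + (γ - 1) * ((2 * (x t).decel γ - (3 * γ - 2)) * (x t).density)) t := fun t ht => by
    refine (((((hx.deriv_Sp t (hlt t ht)).sub_const (1 / 2)).pow 2).const_mul (4 / 3)).add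
      ((hx.deriv_density (hlt t ht)).const_mul (γ - 1))).congr_deriv ?_
    rw [State.spRate]
    push_cast
    ring
  refine eventually_lt_of_tendsto_of_le_deriv (K := 60) hl hL hg (fun t ht => ?_)
    tendsto_const_nhds (fun t ht => by rw [sub_zero]; exact hrate t ht) hε
  have hSp := abs_lt.1 (hadm t ht).abs_Sp_lt
  have h3 := abs_le.1 ((hadm t ht).abs_spRate_le h₁ h₂)
  have h4 : |((x t).Sp - 1 / 2) * (x t).spRate γ| ≤ 3 / 2 * 10 := by
    rw [abs_mul]
    exact mul_le_mul (abs_le.2 ⟨by linarith, by linarith⟩) ((hadm t ht).abs_spRate_le h₁ h₂)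
      (abs_nonneg _) (by norm_num)
  have h5 := (hadm t ht).decel_nonneg h₁
  have h6 : -4 ≤ (2 * (x t).decel γ - (3 * γ - 2)) * (x t).density := by
    nlinarith [(hadm t ht).density_pos, (hadm t ht).density_lt]
  nlinarith [(abs_le.1 h4).1]

theorem tendsto_Sp (hx : IsCosmology γ τ₀ x) (h₁ : 1 ≤ γ) (h₂ : γ ≤ 2) :
    Tendsto (fun t => (x t).Sp) atTop (𝓝 (1 / 2)) := by
  rw [Metric.tendsto_nhds]
  intro ε hε
  filter_upwards [hx.eventually_lyapunov_lt h₁ h₂ (show 0 < ε ^ 2 by positivity),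
    eventually_gt_atTop τ₀] with t ht htτ
  rw [Real.dist_eq]
  refine abs_lt_of_sq_lt_sq ?_ hε.le
  nlinarith [mul_nonneg (sub_nonneg.2 h₁) (hx.admissible t htτ).density_pos.le,
    sq_nonneg ((x t).Sp - 1 / 2)]

theorem eventually_rsq_add_density_lt (hx : IsCosmology γ τ₀ x) (h₁ : 1 ≤ γ) (h₂ : γ ≤ 2)
    {ε : ℝ} (hε : 0 < ε) : ∀ᶠ t in atTop,
      3 / 2 * ((x t).Sm ^ 2 + (x t).Nm ^ 2)
        + 3 / 4 * (2 - γ) * (x t).density < ε := by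
  set a := τ₀ + 1 with ha
  have hlt : ∀ t, a ≤ t → τ₀ < t := fun t ht => by linarith
  have hadm : ∀ t, a ≤ t → (x t).IsAdmissible := fun t ht => hx.admissible t (hlt t ht)
  have hM := hx.tendsto_M h₁ h₂
  have hSp := hx.tendsto_Sp h₁ h₂
  have hosc : Tendsto (fun t => (x t).osc) atTop (𝓝 0) := by
    refine tendsto_of_abs_le hM ?_
    filter_upwards [eventually_ge_atTop a] with t ht
    rw [sub_zero]
    linarith [(hadm t ht).abs_osc_le, (hadm t ht).M_pos]
  have hl : Tendsto (fun t => -((x t).Sp - (x t).osc * ((x t).Sp + 1) / 2)) atTop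
      (𝓝 (-(1 / 2 - 0 * (1 / 2 + 1) / 2))) :=
    (hSp.sub ((hosc.mul (hSp.add_const 1)).div_const 2)).neg
  have he : Tendsto (fun t => 12 * |(x t).Sp - 1 / 2| + 20 * (x t).M) atTop (𝓝 0) := by
    have := ((hSp.sub_const (1 / 2)).abs.const_mul 12).add (hM.const_mul 20)
    simpa using this
  refine eventually_lt_of_tendsto_of_le_deriv (a := a) (K := 60) hl
    (fun t ht => (((hx.deriv_Sp t (hlt t ht)).sub
      (((hx.deriv_osc (hlt t ht)).mul ((hx.deriv_Sp t (hlt t ht)).add_const 1)).div_const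
        2)).neg))
    (fun t ht => ((hx.deriv_rsq (hlt t ht)).const_mul (3 / 2)).add
      ((hx.deriv_density (hlt t ht)).const_mul _)) (fun t ht => ?_) he (fun t ht => ?_) hε
  · have h3 := abs_le.1 ((hadm t ht).abs_rRate_le h₁ h₂)
    have h4 := (hadm t ht).rsq_lt
    have h5 := (hadm t ht).decel_nonneg h₁
    have h6 : -4 ≤ (2 * (x t).decel γ - (3 * γ - 2)) * (x t).density := by
      nlinarith [(hadm t ht).density_pos, (hadm t ht).density_lt]
    nlinarith
  · have := (hadm t ht).spRate_corrected_le h₁ h₂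
    rw [State.spRate] at this
    simp only [Pi.add_apply]
    linarith

theorem tendsto_rsq (hx : IsCosmology γ τ₀ x) (h₁ : 1 ≤ γ) (h₂ : γ ≤ 2) :
    Tendsto (fun t => (x t).Sm ^ 2 + (x t).Nm ^ 2) atTop (𝓝 0) := by
  rw [Metric.tendsto_nhds]
  intro ε hε
  filter_upwards [hx.eventually_rsq_add_density_lt h₁ h₂ hε, eventually_gt_atTop τ₀] with t ht htτ
  rw [dist_zero_right, Real.norm_of_nonneg (by positivity)]
  nlinarith [(hx.admissible t htτ).density_pos, sq_nonneg (x t).Sm, sq_nonneg (x t).Nm]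

theorem tendsto_density (hx : IsCosmology γ τ₀ x) (h₁ : 1 ≤ γ) (h₂ : γ ≤ 2) :
    Tendsto (fun t => (x t).density) atTop (𝓝 0) := by
  rw [Metric.tendsto_nhds]
  intro ε hε
  -- The coefficients `γ - 1` and `3 (2 - γ) / 4` of `Ω` in the two estimates do not both vanish.
  filter_upwards [hx.eventually_rsq_add_density_lt h₁ h₂ (show 0 < ε / 4 by positivity),
    hx.eventually_lyapunov_lt h₁ h₂ (show 0 < ε / 4 by positivity),
    eventually_gt_atTop τ₀] with t ht ht' htτ
  have h3 := (hx.admissible t htτ).density_pos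
  rw [dist_zero_right, Real.norm_of_nonneg h3.le]
  nlinarith [sq_nonneg (x t).Sm, sq_nonneg (x t).Nm, sq_nonneg ((x t).Sp - 1 / 2)]

theorem tendsto_N1 (hx : IsCosmology γ τ₀ x) (h₁ : 1 ≤ γ) (h₂ : γ ≤ 2) :
    Tendsto (fun t => (x t).N1) atTop (𝓝 0) := by
  have := (hx.tendsto_M h₁ h₂).const_mul 3
  rw [mul_zero] at this
  refine tendsto_of_abs_le this ?_
  filter_upwards [eventually_gt_atTop τ₀] with t ht
  rw [sub_zero]
  exact (hx.admissible t ht).abs_N1_le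

theorem tendsto_zsq (hx : IsCosmology γ τ₀ x) (h₁ : 1 ≤ γ) (h₂ : γ ≤ 2) :
    Tendsto (fun t => -(1 / 3) * (x t).N1 * (x t).Np) atTop (𝓝 (3 / 4)) := by
  have := ((((hx.tendsto_Sp h₁ h₂).pow 2).const_sub 1).sub (hx.tendsto_rsq h₁ h₂)).sub
    ((((hx.tendsto_N1 h₁ h₂).pow 2).const_mul (1 / 12)).add (hx.tendsto_density h₁ h₂))
  refine (this.congr fun t => ?_).trans_eq ?_
  · rw [State.density]; ring
  · norm_num

end IsCosmology

/-! ### The ratio `M / R` -/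

/-- The expression on the left is the derivative of `log (M / R) - (3 / 4) osc / R²`. The coefficient
`3 / 4` is half the limit of `1 + Σ₊`, the coefficient of the oscillating `(Σ₋² - N₋²) / R²`. -/
theorem State.IsAdmissible.log_ratioRate_le {γ : ℝ} {s : State} (h : s.IsAdmissible)
    (h₁ : 1 ≤ γ) (h₂ : γ ≤ 2) {r : ℝ} (hr : s.Sm ^ 2 + s.Nm ^ 2 = r) (hr0 : 0 < r) :
    -(s.decel γ + 2 * s.Sp + 6 * s.osc) - s.rRate γ / r
        - 3 / 4 * (s.oscRate γ / r - s.osc / r * (2 * (s.rRate γ / r))) ≤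
      1 - 4 * s.Sp ^ 2 - 3 * s.Sp + |s.Sp - 1 / 2| + 15 * s.M := by
  obtain ⟨u, hu⟩ : ∃ u, u = (s.Sm ^ 2 - s.Nm ^ 2) / r := ⟨_, rfl⟩
  obtain ⟨v, hv⟩ : ∃ v, v = s.Sm * s.Nm / r := ⟨_, rfl⟩
  obtain ⟨y, hy⟩ : ∃ y, y = s.Nm ^ 2 / r := ⟨_, rfl⟩
  obtain ⟨b, hb⟩ : ∃ b, b = s.osc / r := ⟨_, rfl⟩
  obtain ⟨ρ, hρ⟩ : ∃ ρ, ρ = s.rRate γ / r := ⟨_, rfl⟩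
  have hM := h.M_pos
  have hu1 : |u| ≤ 1 := by
    rw [hu, abs_div, abs_of_pos hr0, div_le_one hr0, abs_le]
    constructor <;> linarith [sq_nonneg s.Sm, sq_nonneg s.Nm]
  have hv1 : |v| ≤ 1 / 2 := by
    rw [hv, abs_div, abs_of_pos hr0, div_le_iff₀ hr0, ← hr]
    linarith [abs_mul_le s]
  have hy0 : 0 ≤ y := hy ▸ div_nonneg (sq_nonneg _) hr0.le
  have hy1 : y ≤ 1 := by
    rw [hy, div_le_one hr0]; linarith [sq_nonneg s.Sm]
  have hb1 : |b| ≤ s.M / 2 := by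
    rw [hb, abs_div, abs_of_pos hr0, div_le_iff₀ hr0, ← hr]
    linarith [h.abs_osc_le_rsq]
  have hρ1 : |ρ| ≤ 6 := by
    rw [hρ, abs_div, abs_of_pos hr0, div_le_iff₀ hr0, ← hr]
    exact h.abs_rRate_le h₁ h₂
  have hρe : ρ = s.decel γ - 1 + s.Sp - (1 + s.Sp) * u + s.N1 * v := by
    rw [eq_div_iff hr0.ne'] at hu hv
    rw [hρ, div_eq_iff hr0.ne', State.rRate]
    linear_combination (s.decel γ - 1 + s.Sp) * hr + (1 + s.Sp) * hu - s.N1 * hv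
  have hosc : s.oscRate γ / r = 2 * u - (2 - s.decel γ) * b + s.N1 * s.M * y - 6 * s.osc * b := by
    rw [hu, hb, hy, State.oscRate]
    ring
  have hq := h.density_le_decel h₁
  have hq0 := h.decel_nonneg h₁
  have hq2 := h.decel_le h₂
  rw [← hρ, ← hb, hosc]
  have e1 : (s.Sp - 1 / 2) * u ≤ |s.Sp - 1 / 2| := by
    refine (le_abs_self _).trans ?_
    rw [abs_mul]
    exact mul_le_of_le_one_right (abs_nonneg _) hu1
  have e2 : |s.N1 * v| ≤ 3 * s.M * (1 / 2) := by
    rw [abs_mul]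
    exact mul_le_mul h.abs_N1_le hv1 (abs_nonneg _) (by positivity)
  have e3 : |(2 - s.decel γ) * b| ≤ 2 * (s.M / 2) := by
    rw [abs_mul, abs_of_nonneg (by linarith)]
    exact mul_le_mul (by linarith) hb1 (abs_nonneg _) (by norm_num)
  have e4 : -(s.N1 * s.M * y) ≤ 4 * s.M := by
    have hN : |s.N1| < 4 := abs_lt_of_sq_lt_sq (by linarith [h.N1_sq_lt]) (by norm_num)
    have h3 : -s.N1 * y ≤ 4 := by nlinarith [(abs_lt.1 hN).1, h.N1_neg]
    have := mul_le_mul_of_nonneg_right h3 hM.le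
    linarith
  have e5 : |s.osc * b| ≤ 1 * (s.M / 2) := by
    rw [abs_mul]
    exact mul_le_mul h.abs_osc_le_one hb1 (abs_nonneg _) zero_le_one
  have e6 : |b * ρ| ≤ s.M / 2 * 6 := by
    rw [abs_mul]
    exact mul_le_mul hb1 hρ1 (abs_nonneg _) (by positivity)
  have e7 := abs_le.1 h.abs_osc_le
  have hd := h.density_pos
  linarith [(abs_le.1 e2).1, (abs_le.1 e3).2, (abs_le.1 e5).2, (abs_le.1 e6).2,
    sq_nonneg s.Sm]

namespace IsCosmology

variable {γ τ₀ : ℝ} {x : ℝ → State}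

/-- `R` cannot vanish in finite time, as `(R²)' ≥ -12 R²`. -/
theorem rsq_pos_of_le (hx : IsCosmology γ τ₀ x) (h₁ : 1 ≤ γ) (h₂ : γ ≤ 2) {a t : ℝ}
    (ha : τ₀ < a) (h0 : 0 < (x a).Sm ^ 2 + (x a).Nm ^ 2) (hat : a ≤ t) :
    0 < (x t).Sm ^ 2 + (x t).Nm ^ 2 := by
  have hd : ∀ u, a ≤ u → HasDerivAt
      (fun t => ((x t).Sm ^ 2 + (x t).Nm ^ 2) * Real.exp (12 * t))
      ((2 * (x u).rRate γ + 12 * ((x u).Sm ^ 2 + (x u).Nm ^ 2)) * Real.exp (12 * u)) u :=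
    fun u hu => by
      refine ((hx.deriv_rsq (ha.trans_le hu)).mul
        (((hasDerivAt_id u).const_mul 12).exp)).congr_deriv ?_
      simp only [id]
      ring
  have := sub_le_sub_of_deriv_le hd (fun u _ => hasDerivAt_const u (0 : ℝ)) (fun u hu =>
    mul_nonneg (by
      linarith [(abs_le.1 ((hx.admissible u (ha.trans_le hu)).abs_rRate_le h₁ h₂)).1])
      (Real.exp_pos _).le) le_rfl hat
  have h3 := mul_pos h0 (Real.exp_pos (12 * a))
  exact pos_of_mul_pos_left (by linarith) (Real.exp_pos (12 * t)).le

theorem tendsto_M_div_R (hx : IsCosmology γ τ₀ x) (h₁ : 1 ≤ γ) (h₂ : γ ≤ 2)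
    (hR : ¬ IsLRS τ₀ x) : Tendsto (fun t => (x t).M / (x t).R) atTop (𝓝 0) := by
  obtain ⟨a, ha, hRa⟩ : ∃ a, τ₀ < a ∧ (x a).R ≠ 0 := by
    simpa [IsLRS] using hR
  have hr : ∀ t, a ≤ t → 0 < (x t).Sm ^ 2 + (x t).Nm ^ 2 := fun t ht =>
    hx.rsq_pos_of_le h₁ h₂ ha
      (Real.sqrt_pos.1 (lt_of_le_of_ne (Real.sqrt_nonneg _) (Ne.symm hRa))) ht
  have hM := hx.tendsto_M h₁ h₂
  have hrate : Tendsto (fun t => 1 - 4 * (x t).Sp ^ 2 - 3 * (x t).Sp + |(x t).Sp - 1 / 2|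
      + 15 * (x t).M) atTop (𝓝 (-(3 / 2))) := by
    have hSp := hx.tendsto_Sp h₁ h₂
    have := (((((hSp.pow 2).const_mul 4).const_sub 1).sub (hSp.const_mul 3)).add
      (hSp.sub_const (1 / 2)).abs).add (hM.const_mul 15)
    refine this.trans_eq ?_
    norm_num
  obtain ⟨b, hb⟩ := eventually_atTop.1 (((hrate.eventually (gt_mem_nhds
    (show (-(3 / 2) : ℝ) < -1 by norm_num))).and (hM.eventually (gt_mem_nhds one_pos))).and
    (eventually_ge_atTop a))
  have hW : ∀ t, b ≤ t → HasDerivAt (fun t => -(Real.log (x t).M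
      - 1 / 2 * Real.log ((x t).Sm ^ 2 + (x t).Nm ^ 2)
      - 3 / 4 * ((x t).osc / ((x t).Sm ^ 2 + (x t).Nm ^ 2)))) _ t := fun t ht =>
    have hτ := ha.trans_le (hb t ht).2
    have hrt := (hr t (hb t ht).2).ne'
    (((hx.deriv_log_M hτ).sub (((hx.deriv_rsq hτ).log hrt).const_mul (1 / 2))).sub
      (((hx.deriv_osc hτ).div (hx.deriv_rsq hτ) hrt).const_mul (3 / 4))).neg
  have hlog : ∀ t, b ≤ t →
      |(x t).osc / ((x t).Sm ^ 2 + (x t).Nm ^ 2)| ≤ 1 := fun t ht => by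
    have hrt := hr t (hb t ht).2
    have h3 := (hx.admissible t (ha.trans_le (hb t ht).2))
    rw [abs_div, abs_of_pos hrt, div_le_iff₀ hrt]
    nlinarith [h3.abs_osc_le_rsq, (hb t ht).1.2, h3.M_pos]
  set c := Real.log (x b).M - 1 / 2 * Real.log ((x b).Sm ^ 2 + (x b).Nm ^ 2)
      - 3 / 4 * ((x b).osc / ((x b).Sm ^ 2 + (x b).Nm ^ 2)) with hc
  have hbound : ∀ t, b ≤ t →
      Real.log (x t).M - 1 / 2 * Real.log ((x t).Sm ^ 2 + (x t).Nm ^ 2) ≤ c + b + 1 - t := by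
    intro t ht
    have := sub_le_sub_of_deriv_le hW (fun t _ => hasDerivAt_id t) (fun u hu => by
      have hru := hr u (hb u hu).2
      have h3 := (hx.admissible u (ha.trans_le (hb u hu).2)).log_ratioRate_le h₁ h₂ rfl hru
      have h4 := (hb u hu).1.1
      refine (show (1 : ℝ) ≤ _ by linarith : (1 : ℝ) ≤ -(-((x u).decel γ + 2 * (x u).Sp
        + 6 * (x u).osc) - (x u).rRate γ / ((x u).Sm ^ 2 + (x u).Nm ^ 2)
        - 3 / 4 * ((x u).oscRate γ / ((x u).Sm ^ 2 + (x u).Nm ^ 2)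
          - (x u).osc / ((x u).Sm ^ 2 + (x u).Nm ^ 2)
            * (2 * ((x u).rRate γ / ((x u).Sm ^ 2 + (x u).Nm ^ 2)))))).trans_eq ?_
      obtain ⟨r, hr⟩ : ∃ r, r = (x u).Sm ^ 2 + (x u).Nm ^ 2 := ⟨_, rfl⟩
      rw [← hr] at hru ⊢
      field_simp) le_rfl ht
    simp only [id, ← hc] at this
    linarith [(abs_le.1 (hlog t ht)).2]
  have hlim : Tendsto (fun t => Real.log (x t).M
      - 1 / 2 * Real.log ((x t).Sm ^ 2 + (x t).Nm ^ 2)) atTop atBot :=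
    tendsto_atBot_mono' _ ((eventually_ge_atTop b).mono hbound)
      (tendsto_atBot_add_const_left _ (c + b + 1) tendsto_neg_atTop_atBot)
  refine (Real.tendsto_exp_atBot.comp hlim).congr' ?_
  filter_upwards [eventually_ge_atTop b] with t ht
  have hMt := (hx.admissible t (ha.trans_le (hb t ht).2)).M_pos
  have hRt : 0 < (x t).R := Real.sqrt_pos.2 (hr t (hb t ht).2)
  rw [Function.comp_apply, show 1 / 2 * Real.log ((x t).Sm ^ 2 + (x t).Nm ^ 2) =
    Real.log (x t).R by rw [State.R, Real.log_sqrt (hr t (hb t ht).2).le]; ring,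
    ← Real.log_div hMt.ne' hRt.ne', Real.exp_log (div_pos hMt hRt)]

end IsCosmology

end

end BianchiVIII

theorem theorem1 (γ : ℝ) (hγ₁ : 1 ≤ γ) (hγ₂ : γ ≤ 2) (τ₀ : ℝ) (x : ℝ → BianchiVIII.State)
    (hx : BianchiVIII.IsCosmology γ τ₀ x) :
    Tendsto (fun τ => ((x τ).Sp, (x τ).R, (x τ).Z, (x τ).M)) atTop
      (𝓝 ((1 / 2 : ℝ), (0 : ℝ), √3 / 2, (0 : ℝ))) ∧
    (¬ BianchiVIII.IsLRS τ₀ x → Tendsto (fun τ => (x τ).M / (x τ).R) atTop (𝓝 0)) := by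
  refine ⟨?_, hx.tendsto_M_div_R hγ₁ hγ₂⟩
  have hR : Tendsto (fun τ => (x τ).R) atTop (𝓝 0) := by
    have := (hx.tendsto_rsq hγ₁ hγ₂).sqrt
    rwa [Real.sqrt_zero] at this
  have hZ : Tendsto (fun τ => (x τ).Z) atTop (𝓝 (√3 / 2)) := by
    have h : √(3 / 4 : ℝ) = √3 / 2 := by
      rw [Real.sqrt_div zero_le_three, show (4 : ℝ) = 2 ^ 2 by norm_num,
        Real.sqrt_sq zero_le_two]
    exact h ▸ (hx.tendsto_zsq hγ₁ hγ₂).sqrt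
  exact (hx.tendsto_Sp hγ₁ hγ₂).prodMk_nhds
    (hR.prodMk_nhds (hZ.prodMk_nhds (hx.tendsto_M hγ₁ hγ₂)))
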